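/- Let $n,m\ge 0$ and $J\ge 0$ be integers, let $\sigma_1>\sigma_2>\cdots>\sigma_J>0$ be real numbers, let $k_1,\dots,k_J\ge 1$ be integers, and suppose that $r=k_1+\cdots+k_J$ satisfies $r\le\min(n,m)$. Let $\Sigma$ be the real $n\times m$ matrix whose first $r$ diagonal entries, starting at the upper left corner, are $\sigma_1$ ($k_1$ times), $\sigma_2$ ($k_2$ times), …, $\sigma_J$ ($k_J$ times), and whose other entries are all zero. The set of real $n\times m$ matrices with nonzero singular values $\sigma_1,\dots,\sigma_J$ of respective multiplicities $k_1,\dots,k_J$, that is, the set $$\{A\in\mathbb R^{n\times m} : A=U\Sigma V^T \text{ for some orthogonal } U\in\mathbb R^{n\times n},\ V\in\mathbb R^{m\times m}\},$$ has real dimension $$\tfrac12 n(n-1)+\tfrac12 m(m-1)-\tfrac12(n-r)(n-r-1)-\tfrac12(m-r)(m-r-1)-\tfrac12\sum_{j=1}^J k_j(k_j-1)=(n+m-r)r-r-\tfrac12\sum_{j=1}^J k_j(k_j-1);$$ precisely, it is a nonempty embedded smooth submanifold of $\mathbb R^{n\times m}$ of this dimension. -/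

import Mathlib

open scoped Matrix ContDiff

-- The space of real `n × m` matrices carries the Frobenius (Euclidean) norm.
attribute [local instance] Matrix.frobeniusNormedAddCommGroup Matrix.frobeniusNormedSpace

/-- `s` is an embedded smooth submanifold, of dimension `d`, of the real normed space `E` :
around each of its points there is a smooth (`C^∞`) diffeomorphism `φ` between open subsets of `E`
that takes `s` to a linear subspace `W` of dimension `d`. -/
def IsSmoothSubmanifold {E : Type*} [NormedAddCommGroup E] [NormedSpace ℝ E]
    (s : Set E) (d : ℕ) : Prop :=
  ∀ x ∈ s, ∃ (φ : OpenPartialHomeomorph E E) (W : Submodule ℝ E),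
    x ∈ φ.source ∧ ContDiffOn ℝ ∞ φ φ.source ∧ ContDiffOn ℝ ∞ φ.symm φ.target ∧
    Module.finrank ℝ W = d ∧ φ '' (s ∩ φ.source) = (W : Set E) ∩ φ.target

/-- `s` has real dimension `d` : it is a nonempty embedded smooth submanifold of dimension `d`. -/
def HasRealDimension {E : Type*} [NormedAddCommGroup E] [NormedSpace ℝ E]
    (s : Set E) (d : ℕ) : Prop :=
  s.Nonempty ∧ IsSmoothSubmanifold s d

/-- The real dimension is well defined: one inequality. -/
theorem HasRealDimension.le {E : Type*} [NormedAddCommGroup E] [NormedSpace ℝ E]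
    [FiniteDimensional ℝ E] {s : Set E} {d e : ℕ}
    (hd : HasRealDimension s d) (he : HasRealDimension s e) : d ≤ e := by
  obtain ⟨⟨x, hx⟩, hd⟩ := hd
  obtain ⟨φ, W, hxφ, hφ, hφ', rfl, hW⟩ := hd x hx
  obtain ⟨ψ, V, hxψ, hψ, hψ', rfl, hV⟩ := he.2 x hx
  have hy : φ x ∈ φ.target := φ.map_source hxφ
  have hxe : φ.symm (φ x) = x := φ.left_inv hxφ
  have d1 : HasFDerivAt φ (fderiv ℝ φ x) x :=
    ((hφ.contDiffAt (φ.open_source.mem_nhds hxφ)).differentiableAt (by simp)).hasFDerivAt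
  have d2 : HasFDerivAt φ.symm (fderiv ℝ φ.symm (φ x)) (φ x) :=
    ((hφ'.contDiffAt (φ.open_target.mem_nhds hy)).differentiableAt (by simp)).hasFDerivAt
  have e1 : HasFDerivAt ψ (fderiv ℝ ψ x) x :=
    ((hψ.contDiffAt (ψ.open_source.mem_nhds hxψ)).differentiableAt (by simp)).hasFDerivAt
  have e2 : HasFDerivAt ψ.symm (fderiv ℝ ψ.symm (ψ x)) (ψ x) :=
    ((hψ'.contDiffAt (ψ.open_target.mem_nhds (ψ.map_source hxψ))).differentiableAt
      (by simp)).hasFDerivAt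
  have i1 : (fderiv ℝ φ x).comp (fderiv ℝ φ.symm (φ x)) = ContinuousLinearMap.id ℝ E := by
    have h : HasFDerivAt (φ ∘ φ.symm) ((fderiv ℝ φ x).comp (fderiv ℝ φ.symm (φ x))) (φ x) :=
      HasFDerivAt.comp (φ x) (by rw [hxe]; exact d1) d2
    refine h.unique ((hasFDerivAt_id (φ x)).congr_of_eventuallyEq ?_)
    filter_upwards [φ.open_target.mem_nhds hy] with z hz using φ.right_inv hz
  have i2 : (fderiv ℝ ψ.symm (ψ x)).comp (fderiv ℝ ψ x) = ContinuousLinearMap.id ℝ E := by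
    refine (HasFDerivAt.comp x e2 e1).unique ((hasFDerivAt_id x).congr_of_eventuallyEq ?_)
    filter_upwards [ψ.open_source.mem_nhds hxψ] with z hz using ψ.left_inv hz
  set L := (fderiv ℝ ψ x).comp (fderiv ℝ φ.symm (φ x)) with hL
  have hinj : Function.Injective L := by
    have : Function.LeftInverse ((fderiv ℝ φ x).comp (fderiv ℝ ψ.symm (ψ x))) L := by
      intro v
      have h2 := DFunLike.congr_fun i2 (fderiv ℝ φ.symm (φ x) v)
      have h1 := DFunLike.congr_fun i1 v
      simp only [ContinuousLinearMap.comp_apply, ContinuousLinearMap.id_apply] at h1 h2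
      simp [hL, h2, h1]
    exact this.injective
  have hg : HasFDerivAt (ψ ∘ φ.symm) L (φ x) :=
    HasFDerivAt.comp (φ x) (by rw [hxe]; exact e1) d2
  have hφxW : φ x ∈ (W : Set E) := by
    have : φ x ∈ φ '' (s ∩ φ.source) := ⟨x, ⟨hx, hxφ⟩, rfl⟩
    rw [hW] at this; exact this.1
  have hmap : ∀ w ∈ W, L w ∈ V := by
    intro w hw
    have hc : HasDerivAt (fun t : ℝ => φ x + t • w) w 0 := by
      simpa using ((hasDerivAt_id (0 : ℝ)).smul_const w).const_add (φ x)
    have hgc : HasDerivAt (fun t : ℝ => (ψ ∘ φ.symm) (φ x + t • w)) (L w) 0 :=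
      HasFDerivAt.comp_hasDerivAt (l := ψ ∘ φ.symm) (0 : ℝ) (by simpa using hg) hc
    have hct : Filter.Tendsto (fun t : ℝ => φ x + t • w) (nhds 0) (nhds (φ x)) := by
      have := hc.continuousAt.tendsto
      simpa using this
    have hev : ∀ᶠ t : ℝ in nhds 0, (ψ ∘ φ.symm) (φ x + t • w) ∈ (V : Set E) := by
      have h2 : ∀ᶠ z in nhds (φ x), φ.symm z ∈ ψ.source := by
        have := d2.continuousAt.tendsto
        rw [hxe] at this
        exact this (ψ.open_source.mem_nhds hxψ)
      filter_upwards [hct (φ.open_target.mem_nhds hy), hct h2] with t ht1 ht2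
      have hin : φ x + t • w ∈ φ '' (s ∩ φ.source) := by
        rw [hW]; exact ⟨W.add_mem hφxW (W.smul_mem t hw), ht1⟩
      obtain ⟨z, ⟨hzs, hzφ⟩, hz⟩ := hin
      have hzz : φ.symm (φ x + t • w) = z := by rw [← hz, φ.left_inv hzφ]
      have : ψ z ∈ ψ '' (s ∩ ψ.source) := ⟨z, ⟨hzs, by rw [← hzz]; exact ht2⟩, rfl⟩
      rw [hV] at this
      simpa [hzz] using this.1
    have hlim := hgc.tendsto_slope
    have h0 := hev.self_of_nhds
    refine V.closed_of_finiteDimensional.mem_of_tendsto hlim ?_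
    filter_upwards [nhdsWithin_le_nhds hev] with t ht
    rw [slope_def_module]
    exact V.smul_mem _ (V.sub_mem ht h0)
  exact LinearMap.finrank_le_finrank_of_injective
    (f := (L : E →ₗ[ℝ] E).restrict hmap)
    (fun a b hab => Subtype.ext (hinj (congrArg Subtype.val hab)))

/-- The real dimension is well defined. -/
theorem HasRealDimension.unique {E : Type*} [NormedAddCommGroup E] [NormedSpace ℝ E]
    [FiniteDimensional ℝ E] {s : Set E} {d e : ℕ}
    (hd : HasRealDimension s d) (he : HasRealDimension s e) : d = e :=
  le_antisymm (hd.le he) (he.le hd)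

/-- The list `σ 0, …, σ 0, σ 1, …, σ 1, …` in which `σ j` is repeated `k j` times. -/
def repeatedValues {J : ℕ} (σ : Fin J → ℝ) (k : Fin J → ℕ) (i : Fin (∑ j, k j)) : ℝ :=
  σ (finSigmaFinEquiv.symm i).1

/-- The `n × m` singular value matrix: its first `∑ j, k j` diagonal entries, from the upper left
corner, are `σ 0` (`k 0` times), `σ 1` (`k 1` times), …; all its other entries are zero. -/
def singularValueMatrix (n m : ℕ) {J : ℕ} (σ : Fin J → ℝ) (k : Fin J → ℕ) :
    Matrix (Fin n) (Fin m) ℝ :=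
  Matrix.of fun i l =>
    if h : (i : ℕ) = (l : ℕ) ∧ (i : ℕ) < ∑ j, k j then repeatedValues σ k ⟨i, h.2⟩ else 0

/-- The set of the real `n × m` matrices `A` that have a singular value decomposition
`A = U S Vᵀ`, with `U` and `V` orthogonal, in which `S` is the given singular value matrix. -/
def matricesWithSingularValueMatrix {n m : ℕ} (S : Matrix (Fin n) (Fin m) ℝ) :
    Set (Matrix (Fin n) (Fin m) ℝ) :=
  {A | ∃ U ∈ Matrix.orthogonalGroup (Fin n) ℝ, ∃ V ∈ Matrix.orthogonalGroup (Fin m) ℝ,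
    A = U * S * Vᵀ}

open Topology Filter

attribute [local instance] Matrix.frobeniusNormedRing Matrix.frobeniusNormedAlgebra

/-! The set is the orbit of `S` under pairs of orthogonal matrices. These act by linear
automorphisms that preserve the orbit, so a chart at `S` suffices.

The tangent space at `S` consists of the `X * S + S * Z` with `X`, `Z` skew. A linear solution of `X
B * S + S * Z B + Q B = B`, with `Q` the projection onto a normal space, makes `exp (X a) * (S + Q
a) * exp (Z a)` a local diffeomorphism at `a = 0`. The exponentials are orthogonal, so the value
lies in the orbit iff `S + Q a` does. It remains to see that the slice `S + range Q` meets the orbit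
near `S` only in `S` (`eventually_slice`); then the orbit corresponds to `ker Q`.

For this rigidity one polynomial identity is enough. With `w` the product of the `X - s ^ 2` over
the distinct positive singular values `s`, every `A` in the orbit satisfies `A * w(Aᵀ * A) = 0`. On
the slice `A` has diagonal blocks `M` (symmetric, near `diagonal d`, zero between different values
of `d`) and `C` (near 0), and the identity forces `M = diagonal d` and `C = 0`. The dimension is
then a count of the free entries of `ker Q`. -/

/-- `s` is, near `x`, an embedded smooth submanifold of dimension `d`. -/
def IsSmoothSubmanifoldAt {E : Type*} [NormedAddCommGroup E] [NormedSpace ℝ E]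
    (s : Set E) (d : ℕ) (x : E) : Prop :=
  ∃ (φ : OpenPartialHomeomorph E E) (W : Submodule ℝ E),
    x ∈ φ.source ∧ ContDiffOn ℝ ∞ φ φ.source ∧ ContDiffOn ℝ ∞ φ.symm φ.target ∧
    Module.finrank ℝ W = d ∧ φ '' (s ∩ φ.source) = (W : Set E) ∩ φ.target

/-! ### Submanifold charts from parametrizations and under linear equivalences -/

section Charts

variable {E F : Type*} [NormedAddCommGroup E] [NormedSpace ℝ E]
  [NormedAddCommGroup F] [NormedSpace ℝ F]

/-- A smooth map with invertible derivative at `a` that takes a linear subspace, near `a`, onto `s`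
gives a submanifold chart of `s`. -/
theorem IsSmoothSubmanifoldAt.of_parametrization [CompleteSpace E] {s : Set E} {Ψ : E → E}
    (hΨ : ContDiff ℝ ∞ Ψ) {a : E} (f' : E ≃L[ℝ] E) (hf' : HasFDerivAt Ψ (f' : E →L[ℝ] E) a)
    (W : Submodule ℝ E) (hs : ∀ᶠ z in 𝓝 a, Ψ z ∈ s ↔ z ∈ W) :
    IsSmoothSubmanifoldAt s (Module.finrank ℝ W) (Ψ a) := by
  have hne : (∞ : WithTop ℕ∞) ≠ 0 := by simp
  let f₀ := hΨ.contDiffAt.toOpenPartialHomeomorph Ψ hf' hne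
  have ha₀ : a ∈ f₀.source := hΨ.contDiffAt.mem_toOpenPartialHomeomorph_source hf' hne
  -- The inverse function theorem gives smoothness of the inverse only at `Ψ a`. Shrinking to a
  -- neighbourhood where the derivative stays invertible gives it on the whole target.
  have hinv : ∀ᶠ z in 𝓝 a, fderiv ℝ Ψ z ∈ Set.range ((↑) : (E ≃L[ℝ] E) → E →L[ℝ] E) := by
    have hc : Continuous (fderiv ℝ Ψ) := hΨ.continuous_fderiv hne
    refine hc.continuousAt.eventually (ContinuousLinearEquiv.isOpen.mem_nhds ?_)
    exact ⟨f', hf'.fderiv.symm⟩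
  obtain ⟨U, hU, hUo, haU⟩ := eventually_nhds_iff.1 (hs.and hinv)
  let e := f₀.restrOpen U hUo
  have hes : e.source = f₀.source ∩ U := OpenPartialHomeomorph.restrOpen_source _ _ _
  have hee : ∀ z, e z = Ψ z := fun z => rfl
  have hee' : (e : E → E) = Ψ := rfl
  have hae : a ∈ e.source := by rw [hes]; exact ⟨ha₀, haU⟩
  -- `Ψ` goes from the subspace to `s`, so the chart is its local inverse.
  refine ⟨e.symm, W, ?_, ?_, ?_, rfl, ?_⟩
  · rw [e.symm_source, ← hee]; exact e.map_source hae
  · intro y hy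
    rw [e.symm_source] at hy
    have hy' := e.map_target hy
    rw [hes] at hy'
    obtain ⟨g, hg⟩ := (hU _ hy'.2).2
    refine (e.contDiffAt_symm (f₀' := g) hy ?_ ?_).contDiffWithinAt
    · rw [hg, hee']
      exact (hΨ.differentiable hne _).hasFDerivAt
    · rw [hee']; exact hΨ.contDiffAt
  · rw [e.symm_symm, hee']; exact hΨ.contDiffOn
  · rw [e.symm_source, e.symm_target]
    ext z
    constructor
    · rintro ⟨y, ⟨hys, hyt⟩, rfl⟩
      have hy' := e.map_target hyt
      refine ⟨?_, hy'⟩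
      rw [hes] at hy'
      refine ((hU _ hy'.2).1).1 ?_
      rw [← hee, e.right_inv hyt]; exact hys
    · rintro ⟨hzW, hz⟩
      refine ⟨e z, ⟨?_, e.map_source hz⟩, e.left_inv hz⟩
      have hz' := hz
      rw [hes] at hz'
      exact ((hU _ hz'.2).1).2 hzW

theorem IsSmoothSubmanifoldAt.image {s : Set E} {d : ℕ} {x : E}
    (h : IsSmoothSubmanifoldAt s d x) (g : E ≃L[ℝ] F) :
    IsSmoothSubmanifoldAt (g '' s) d (g x) := by
  obtain ⟨φ, W, hx, h1, h2, hd, hW⟩ := h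
  let G := g.toHomeomorph.toOpenPartialHomeomorph
  let ψ : OpenPartialHomeomorph F F := (G.symm.trans φ).trans G
  have hsrc : ψ.source = g.symm ⁻¹' φ.source := by
    ext y; simp [ψ, G]
  have htgt : ψ.target = g.symm ⁻¹' φ.target := by
    ext y; simp [ψ, G]
  have hψ : (ψ : F → F) = g ∘ φ ∘ g.symm := rfl
  have hψs : (ψ.symm : F → F) = g ∘ φ.symm ∘ g.symm := rfl
  refine ⟨ψ, W.map (g.toLinearEquiv : E →ₗ[ℝ] F), ?_, ?_, ?_, ?_, ?_⟩
  · rw [hsrc]; simpa using hx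
  · rw [hψ, hsrc]
    exact g.contDiff.comp_contDiffOn
      (h1.comp g.symm.contDiff.contDiffOn (fun y hy => hy))
  · rw [hψs, htgt]
    exact g.contDiff.comp_contDiffOn
      (h2.comp g.symm.contDiff.contDiffOn (fun y hy => hy))
  · rw [← hd]; exact LinearEquiv.finrank_map_eq g.toLinearEquiv W
  · have e1 : g '' s ∩ ψ.source = g '' (s ∩ φ.source) := by
      rw [hsrc, Set.image_inter g.injective]
      congr 1
      ext y
      exact ⟨fun hy => ⟨_, hy, by simp⟩, by rintro ⟨z, hz, rfl⟩; simpa using hz⟩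
    have e2 : ψ.target = g '' φ.target := by
      rw [htgt]
      ext y
      exact ⟨fun hy => ⟨_, hy, by simp⟩, by rintro ⟨z, hz, rfl⟩; simpa using hz⟩
    have e3 : ((W.map (g.toLinearEquiv : E →ₗ[ℝ] F) : Submodule ℝ F) : Set F) = g '' (W : Set E) :=
      rfl
    rw [e1, e2, e3, ← Set.image_inter g.injective, ← hW, hψ, Set.image_image, Set.image_image]
    simp

theorem IsSmoothSubmanifold.image {s : Set E} {d : ℕ} (h : IsSmoothSubmanifold s d)
    (g : E ≃L[ℝ] F) : IsSmoothSubmanifold (g '' s) d := by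
  rintro _ ⟨x, hx, rfl⟩
  exact IsSmoothSubmanifoldAt.image (h x hx) g

end Charts

/-! ### Orbits of pairs of orthogonal matrices and linear slices -/

namespace Matrix

section Smooth

variable {l m n : Type*} [Fintype l] [Fintype m] [Fintype n]

theorem isBoundedBilinearMap_mul :
    IsBoundedBilinearMap ℝ (fun p : Matrix l m ℝ × Matrix m n ℝ => p.1 * p.2) where
  add_left A B C := Matrix.add_mul A B C
  smul_left c A B := Matrix.smul_mul c A B
  add_right A B C := Matrix.mul_add A B C
  smul_right c A B := Matrix.mul_smul A c B
  bound := ⟨1, one_pos, fun A B => by simpa using frobenius_norm_mul A B⟩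

theorem contDiff_exp [DecidableEq n] :
    ContDiff ℝ ∞ (NormedSpace.exp : Matrix n n ℝ → Matrix n n ℝ) :=
  contDiff_iff_contDiffAt.2 fun x => (NormedSpace.exp_analytic (𝕂 := ℝ) x).contDiffAt

theorem exp_mem_orthogonalGroup [DecidableEq n] {X : Matrix n n ℝ} (hX : Xᵀ = -X) :
    NormedSpace.exp X ∈ Matrix.orthogonalGroup n ℝ := by
  rw [mem_orthogonalGroup_iff, ← Matrix.exp_transpose, hX, Matrix.exp_neg]
  exact Matrix.mul_nonsing_inv _ ((Matrix.isUnit_iff_isUnit_det _).1 (Matrix.isUnit_exp X))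

variable [DecidableEq m] [DecidableEq n]

/-- The orbit of `S` under the action of pairs of orthogonal matrices. -/
def orthogonalOrbit (S : Matrix n m ℝ) : Set (Matrix n m ℝ) :=
  {A | ∃ U ∈ Matrix.orthogonalGroup n ℝ, ∃ V ∈ Matrix.orthogonalGroup m ℝ, A = U * S * Vᵀ}

theorem self_mem_orthogonalOrbit (S : Matrix n m ℝ) : S ∈ orthogonalOrbit S :=
  ⟨1, one_mem _, 1, one_mem _, by simp⟩

theorem transpose_mem_orthogonalGroup {V : Matrix m m ℝ}
    (hV : V ∈ Matrix.orthogonalGroup m ℝ) : Vᵀ ∈ Matrix.orthogonalGroup m ℝ := by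
  rw [mem_orthogonalGroup_iff, transpose_transpose]
  exact (mem_orthogonalGroup_iff' _ _).1 hV

theorem mul_mul_mem_orthogonalOrbit {S A : Matrix n m ℝ} {U : Matrix n n ℝ} {V : Matrix m m ℝ}
    (hU : U ∈ Matrix.orthogonalGroup n ℝ) (hV : V ∈ Matrix.orthogonalGroup m ℝ)
    (hA : A ∈ orthogonalOrbit S) : U * A * V ∈ orthogonalOrbit S := by
  obtain ⟨U', hU', V', hV', rfl⟩ := hA
  refine ⟨U * U', mul_mem hU hU', Vᵀ * V', mul_mem (transpose_mem_orthogonalGroup hV) hV', ?_⟩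
  simp [Matrix.mul_assoc]

theorem mul_mul_mem_orthogonalOrbit_iff {S A : Matrix n m ℝ} {U : Matrix n n ℝ} {V : Matrix m m ℝ}
    (hU : U ∈ Matrix.orthogonalGroup n ℝ) (hV : V ∈ Matrix.orthogonalGroup m ℝ) :
    U * A * V ∈ orthogonalOrbit S ↔ A ∈ orthogonalOrbit S := by
  refine ⟨fun h => ?_, mul_mul_mem_orthogonalOrbit hU hV⟩
  have h2 := mul_mul_mem_orthogonalOrbit (transpose_mem_orthogonalGroup hU)
    (transpose_mem_orthogonalGroup hV) h
  have e : Uᵀ * (U * A * V) * Vᵀ = (Uᵀ * U) * A * (V * Vᵀ) := by simp only [Matrix.mul_assoc]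
  rwa [e, (mem_orthogonalGroup_iff' _ _).1 hU, (mem_orthogonalGroup_iff _ _).1 hV, Matrix.one_mul,
    Matrix.mul_one] at h2

/-- The action of a pair of orthogonal matrices, as a linear equivalence. -/
def orthogonalEquiv {U : Matrix n n ℝ} {V : Matrix m m ℝ}
    (hU : U ∈ Matrix.orthogonalGroup n ℝ) (hV : V ∈ Matrix.orthogonalGroup m ℝ) :
    Matrix n m ℝ ≃ₗ[ℝ] Matrix n m ℝ where
  toFun A := U * A * V
  invFun A := Uᵀ * A * Vᵀ
  map_add' A B := by rw [Matrix.mul_add, Matrix.add_mul]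
  map_smul' c A := by simp
  left_inv A := by
    have e : Uᵀ * (U * A * V) * Vᵀ = (Uᵀ * U) * A * (V * Vᵀ) := by simp only [Matrix.mul_assoc]
    simp only [e, (mem_orthogonalGroup_iff' _ _).1 hU, (mem_orthogonalGroup_iff _ _).1 hV, Matrix.one_mul,
      Matrix.mul_one]
  right_inv A := by
    have e : U * (Uᵀ * A * Vᵀ) * V = (U * Uᵀ) * A * (Vᵀ * V) := by simp only [Matrix.mul_assoc]
    simp only [e, (mem_orthogonalGroup_iff _ _).1 hU, (mem_orthogonalGroup_iff' _ _).1 hV, Matrix.one_mul,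
      Matrix.mul_one]

/-- Homogeneity: the group element that takes `S` to `x` is a linear automorphism preserving the
orbit, and it carries the chart at `S` to one at `x`. -/
theorem isSmoothSubmanifold_orthogonalOrbit_of_at {S : Matrix n m ℝ} {d : ℕ}
    (h : IsSmoothSubmanifoldAt (orthogonalOrbit S) d S) :
    IsSmoothSubmanifold (orthogonalOrbit S) d := by
  rintro x ⟨U, hU, V, hV, rfl⟩
  have hV' := transpose_mem_orthogonalGroup hV
  let g := (orthogonalEquiv hU hV').toContinuousLinearEquiv
  have key : IsSmoothSubmanifoldAt (g '' orthogonalOrbit S) d (g S) := h.image g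
  have e : g '' orthogonalOrbit S = orthogonalOrbit S := by
    ext A
    constructor
    · rintro ⟨B, hB, rfl⟩
      exact mul_mul_mem_orthogonalOrbit hU hV' hB
    · intro hA
      refine ⟨g.symm A, ?_, g.apply_symm_apply A⟩
      refine (mul_mul_mem_orthogonalOrbit_iff hU hV').1 ?_
      have h2 : U * g.symm A * Vᵀ = A := g.apply_symm_apply A
      rwa [h2]
  rw [e] at key
  exact key

theorem contDiff_exp_mul_mul_exp (S : Matrix n m ℝ) (X : Matrix n m ℝ →L[ℝ] Matrix n n ℝ)
    (Q : Matrix n m ℝ →L[ℝ] Matrix n m ℝ) (Z : Matrix n m ℝ →L[ℝ] Matrix m m ℝ) :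
    ContDiff ℝ ∞ (fun a => NormedSpace.exp (X a) * (S + Q a) * NormedSpace.exp (Z a)) := by
  have hX : ContDiff ℝ ∞ (fun a => NormedSpace.exp (X a)) := contDiff_exp.comp X.contDiff
  have hZ : ContDiff ℝ ∞ (fun a => NormedSpace.exp (Z a)) := contDiff_exp.comp Z.contDiff
  have hQ : ContDiff ℝ ∞ (fun a => S + Q a) := contDiff_const.add Q.contDiff
  have h1 : ContDiff ℝ ∞ (fun a => NormedSpace.exp (X a) * (S + Q a)) :=
    isBoundedBilinearMap_mul.contDiff.comp (hX.prodMk hQ)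
  exact isBoundedBilinearMap_mul.contDiff.comp (h1.prodMk hZ)

/-- Product rule at 0, where both exponentials are 1 and have derivatives `X` and `Z`; the
hypothesis `h` says that the three terms add up to `B`. -/
theorem hasFDerivAt_exp_mul_mul_exp (S : Matrix n m ℝ) (X : Matrix n m ℝ →L[ℝ] Matrix n n ℝ)
    (Q : Matrix n m ℝ →L[ℝ] Matrix n m ℝ) (Z : Matrix n m ℝ →L[ℝ] Matrix m m ℝ)
    (h : ∀ B, X B * S + S * Z B + Q B = B) :
    HasFDerivAt (fun a => NormedSpace.exp (X a) * (S + Q a) * NormedSpace.exp (Z a))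
      (ContinuousLinearMap.id ℝ (Matrix n m ℝ)) 0 := by
  have hX : HasFDerivAt (fun a => NormedSpace.exp (X a)) X 0 := by
    have h0 : HasFDerivAt (NormedSpace.exp : Matrix n n ℝ → Matrix n n ℝ)
      (1 : Matrix n n ℝ →L[ℝ] Matrix n n ℝ) (X 0) := by
      rw [map_zero]; exact hasFDerivAt_exp_zero
    exact h0.comp (0 : Matrix n m ℝ) X.hasFDerivAt
  have hZ : HasFDerivAt (fun a => NormedSpace.exp (Z a)) Z 0 := by
    have h0 : HasFDerivAt (NormedSpace.exp : Matrix m m ℝ → Matrix m m ℝ)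
      (1 : Matrix m m ℝ →L[ℝ] Matrix m m ℝ) (Z 0) := by
      rw [map_zero]; exact hasFDerivAt_exp_zero
    exact h0.comp (0 : Matrix n m ℝ) Z.hasFDerivAt
  have hQ : HasFDerivAt (fun a => S + Q a) Q 0 := Q.hasFDerivAt.const_add S
  have h1 := ((isBoundedBilinearMap_mul (l := n) (m := n) (n := m)).hasFDerivAt
    (NormedSpace.exp (X 0), S + Q 0)).comp (0 : Matrix n m ℝ) (hX.prodMk hQ)
  have h2 := ((isBoundedBilinearMap_mul (l := n) (m := m) (n := m)).hasFDerivAt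
    (NormedSpace.exp (X 0) * (S + Q 0), NormedSpace.exp (Z 0))).comp (0 : Matrix n m ℝ)
      (h1.prodMk hZ)
  refine h2.congr_fderiv ?_
  ext1 B
  change NormedSpace.exp (X 0) * (S + Q 0) * Z B +
    (NormedSpace.exp (X 0) * Q B + X B * (S + Q 0)) * NormedSpace.exp (Z 0) = B
  rw [map_zero, map_zero, map_zero, NormedSpace.exp_zero, NormedSpace.exp_zero, add_zero,
    Matrix.one_mul, Matrix.one_mul, Matrix.mul_one]
  refine Eq.trans ?_ (h B)
  abel

/-- A linear slice at `S` for the action of pairs of orthogonal matrices makes the orbit of `S` a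
submanifold. -/
theorem isSmoothSubmanifold_orthogonalOrbit_of_slice (S : Matrix n m ℝ)
    (X : Matrix n m ℝ →ₗ[ℝ] Matrix n n ℝ) (Q : Matrix n m ℝ →ₗ[ℝ] Matrix n m ℝ)
    (Z : Matrix n m ℝ →ₗ[ℝ] Matrix m m ℝ) (h : ∀ B, X B * S + S * Z B + Q B = B)
    (hX : ∀ B, (X B)ᵀ = -X B) (hZ : ∀ B, (Z B)ᵀ = -Z B)
    (hslice : ∀ᶠ B in 𝓝 (0 : Matrix n m ℝ), S + Q B ∈ orthogonalOrbit S → Q B = 0) :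
    IsSmoothSubmanifold (orthogonalOrbit S) (Module.finrank ℝ (LinearMap.ker Q)) := by
  refine isSmoothSubmanifold_orthogonalOrbit_of_at ?_
  have key := IsSmoothSubmanifoldAt.of_parametrization (s := orthogonalOrbit S)
    (contDiff_exp_mul_mul_exp S X.toContinuousLinearMap Q.toContinuousLinearMap
      Z.toContinuousLinearMap) (ContinuousLinearEquiv.refl ℝ _)
    (hasFDerivAt_exp_mul_mul_exp S X.toContinuousLinearMap Q.toContinuousLinearMap
      Z.toContinuousLinearMap h) (LinearMap.ker Q) ?_
  · simpa using key
  · filter_upwards [hslice] with B hB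
    have hUX := exp_mem_orthogonalGroup (hX B)
    have hUZ := exp_mem_orthogonalGroup (hZ B)
    refine (mul_mul_mem_orthogonalOrbit_iff hUX hUZ).trans ⟨hB, fun hQ => ?_⟩
    have hQ' : Q B = 0 := hQ
    simpa [hQ'] using self_mem_orthogonalOrbit S

end Smooth

end Matrix

/-! ### The annihilating polynomial and its cofactors -/

namespace Matrix

section RootsPolynomials

open Polynomial

variable {ι : Type*} [Fintype ι]

/-- The monic polynomial whose roots are the squares of the values of `d`. -/
noncomputable def sqRootsPoly (d : ι → ℝ) : ℝ[X] :=
  ∏ s ∈ Finset.univ.image d, (X - C (s ^ 2))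

theorem eval_sq_sqRootsPoly (d : ι → ℝ) (i : ι) : (sqRootsPoly d).eval (d i ^ 2) = 0 := by
  rw [sqRootsPoly, eval_prod]
  exact Finset.prod_eq_zero (Finset.mem_image_of_mem d (Finset.mem_univ i)) (by simp)

theorem eval_zero_sqRootsPoly {d : ι → ℝ} (hd : ∀ i, 0 < d i) : (sqRootsPoly d).eval 0 ≠ 0 := by
  rw [sqRootsPoly, eval_prod, Finset.prod_ne_zero_iff]
  intro s hs
  obtain ⟨i, -, rfl⟩ := Finset.mem_image.1 hs
  simpa using (hd i).ne'

/-- The cofactor of `X - s` in `X * ∏ (X ^ 2 - t ^ 2)`. -/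
noncomputable def sqCofactor (d : ι → ℝ) (s : ℝ) : ℝ[X] :=
  X * (X + C s) * ∏ t ∈ (Finset.univ.image d).erase s, (X ^ 2 - C (t ^ 2))

theorem sqCofactor_mul (d : ι → ℝ) (i : ι) :
    sqCofactor d (d i) * (X - C (d i)) = X * (sqRootsPoly d).comp (X ^ 2) := by
  have h := Finset.mul_prod_erase (Finset.univ.image d) (fun t => (X ^ 2 - C (t ^ 2) : ℝ[X]))
    (Finset.mem_image_of_mem d (Finset.mem_univ i))
  have h2 : (sqRootsPoly d).comp (X ^ 2) = ∏ t ∈ Finset.univ.image d, (X ^ 2 - C (t ^ 2)) := by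
    simp [sqRootsPoly, prod_comp]
  rw [h2, ← h, sqCofactor, C_pow]
  ring

/-- `d i` is a simple root of `X * ∏ (X ^ 2 - t ^ 2)`: the product runs over distinct values, and
squaring is injective on positive numbers. -/
theorem eval_sqCofactor_ne_zero {d : ι → ℝ} (hd : ∀ i, 0 < d i) (i : ι) :
    (sqCofactor d (d i)).eval (d i) ≠ 0 := by
  rw [sqCofactor, eval_mul, eval_prod]
  refine mul_ne_zero ?_ (Finset.prod_ne_zero_iff.2 fun t ht => ?_)
  · have := hd i
    simp only [eval_mul, eval_add, eval_X, eval_C]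
    positivity
  · obtain ⟨hne, ht⟩ := Finset.mem_erase.1 ht
    obtain ⟨j, -, rfl⟩ := Finset.mem_image.1 ht
    simp only [eval_sub, eval_pow, eval_X, eval_C, sub_ne_zero]
    intro h
    exact hne ((sq_eq_sq₀ (hd j).le (hd i).le).1 h.symm)

end RootsPolynomials

/-! ### Rigidity: the slice meets the orbit only at its base point -/

section Rigidity

open Polynomial

variable {ι α β m n : Type*} [Fintype ι] [Fintype α] [Fintype β] [Fintype m] [Fintype n]
  [DecidableEq ι] [DecidableEq α] [DecidableEq β] [DecidableEq m] [DecidableEq n]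

theorem aeval_mul_of_mul_eq {X : Matrix n n ℝ} {Z : Matrix n m ℝ} {Y : Matrix m m ℝ}
    (h : X * Z = Z * Y) (w : ℝ[X]) : aeval X w * Z = Z * aeval Y w := by
  have hp : ∀ k : ℕ, X ^ k * Z = Z * Y ^ k := by
    intro k
    induction k with
    | zero => simp
    | succ k ih => rw [pow_succ, Matrix.mul_assoc, h, ← Matrix.mul_assoc, ih, Matrix.mul_assoc,
        ← pow_succ]
  induction w using Polynomial.induction_on' with
  | add p q hp hq => simp [Matrix.add_mul, Matrix.mul_add, hp, hq]
  | monomial k a => simp [aeval_monomial, Algebra.algebraMap_eq_smul_one, hp]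

theorem aeval_fromBlocks_diagonal (A : Matrix m m ℝ) (B : Matrix n n ℝ) (w : ℝ[X]) :
    aeval (fromBlocks A 0 0 B) w = fromBlocks (aeval A w) 0 0 (aeval B w) := by
  have hp : ∀ k : ℕ, fromBlocks A 0 0 B ^ k = fromBlocks (A ^ k) 0 0 (B ^ k) := by
    intro k
    induction k with
    | zero => simp
    | succ k ih => simp [pow_succ, ih, fromBlocks_multiply]
  induction w using Polynomial.induction_on' with
  | add p q hp hq => simp [hp, hq, fromBlocks_add]
  | monomial k a =>
    simp [aeval_monomial, Algebra.algebraMap_eq_smul_one, hp, fromBlocks_smul]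

theorem aeval_diagonal (d : ι → ℝ) (w : ℝ[X]) :
    aeval (diagonal d) w = diagonal (fun i => w.eval (d i)) := by
  have h := aeval_algHom_apply (diagonalAlgHom (n := ι) (α := ℝ) ℝ) d w
  have h2 : aeval d w = fun i => w.eval (d i) := by
    ext i
    simp [← coe_aeval_eq_eval]
  rw [h2] at h
  exact h

/-- For `A = U * S * Vᵀ` the Gram matrix `Aᵀ * A` is conjugate to `Sᵀ * S` by `V`, so `A * w(Aᵀ * A)
= U * (S * w(Sᵀ * S)) * Vᵀ`. -/
theorem mul_aeval_eq_zero_of_mem_orthogonalOrbit {S A : Matrix n m ℝ}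
    (hA : A ∈ orthogonalOrbit S) {w : ℝ[X]} (hw : S * aeval (Sᵀ * S) w = 0) :
    A * aeval (Aᵀ * A) w = 0 := by
  obtain ⟨U, hU, V, hV, rfl⟩ := hA
  have hU' := (mem_orthogonalGroup_iff' _ _).1 hU
  have hV' := (mem_orthogonalGroup_iff' _ _).1 hV
  have hV'' := (mem_orthogonalGroup_iff _ _).1 hV
  have e : ((U * S * Vᵀ)ᵀ * (U * S * Vᵀ)) * V = V * (Sᵀ * S) := by
    have : ((U * S * Vᵀ)ᵀ * (U * S * Vᵀ)) * V = V * Sᵀ * (Uᵀ * U) * S * (Vᵀ * V) := by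
      simp only [transpose_mul, transpose_transpose, Matrix.mul_assoc]
    rw [this, hU', hV']
    simp only [Matrix.mul_one, Matrix.mul_assoc]
  have h1 := aeval_mul_of_mul_eq e w
  set K := aeval ((U * S * Vᵀ)ᵀ * (U * S * Vᵀ)) w
  have h2 : U * S * Vᵀ * K = U * S * Vᵀ * (K * V) * Vᵀ := by
    have : U * S * Vᵀ * (K * V) * Vᵀ = U * S * Vᵀ * K * (V * Vᵀ) := by
      simp only [Matrix.mul_assoc]
    rw [this, hV'', Matrix.mul_one]
  have h3 : U * S * Vᵀ * (V * aeval (Sᵀ * S) w) * Vᵀ =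
      U * (S * ((Vᵀ * V) * aeval (Sᵀ * S) w)) * Vᵀ := by
    simp only [Matrix.mul_assoc]
  rw [h2, h1, h3, hV', Matrix.one_mul, hw, Matrix.mul_zero, Matrix.zero_mul]

/-- At `A = 0` the matrix `w(Aᵀ * A)` is the nonzero scalar `w(0)`; it stays invertible nearby and
can be cancelled. -/
theorem eventually_eq_zero_of_mul_aeval_eq_zero {n m : Type*} [Fintype n] [Fintype m]
    [DecidableEq m] {w : ℝ[X]} (hw : w.eval 0 ≠ 0) :
    ∀ᶠ A in 𝓝 (0 : Matrix n m ℝ), A * aeval (Aᵀ * A) w = 0 → A = 0 := by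
  have hc : Continuous fun A : Matrix n m ℝ => (aeval (Aᵀ * A) w).det := by
    refine Continuous.matrix_det ?_
    exact (Polynomial.continuous_aeval w).comp
      (Continuous.matrix_mul continuous_id.matrix_transpose continuous_id)
  have h0 : (aeval ((0 : Matrix n m ℝ)ᵀ * (0 : Matrix n m ℝ)) w).det ≠ 0 := by
    have := aeval_diagonal (0 : m → ℝ) w
    rw [show (diagonal (0 : m → ℝ)) = 0 from diagonal_zero] at this
    rw [Matrix.mul_zero, this, det_diagonal]
    exact Finset.prod_ne_zero_iff.2 fun i _ => hw
  filter_upwards [hc.continuousAt.eventually_ne h0] with A hA hAw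
  have hu : IsUnit (aeval (Aᵀ * A) w).det := isUnit_iff_ne_zero.2 hA
  rw [← Matrix.mul_one A, ← Matrix.mul_nonsing_inv _ hu, ← Matrix.mul_assoc, hAw, Matrix.zero_mul]

/-- With `g_s` the cofactor, the identity reads `g_s(M) * (M - s) = 0` for each value `s` of `d`.
Near `diagonal d` the factor `g_s(M)` is invertible only on the block of `s`, so the cofactors of
the different blocks are assembled into one invertible matrix. -/
theorem eventually_eq_diagonal_of_mul_aeval_eq_zero {d : ι → ℝ} (hd : ∀ i, 0 < d i) :
    ∀ᶠ M in 𝓝 (diagonal d), (∀ i j, d i ≠ d j → M i j = 0) →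
      M * aeval (M * M) (sqRootsPoly d) = 0 → M = diagonal d := by
  -- Column `i` of `G M` is column `i` of the cofactor of `d i` evaluated at `M`; thus `G (diagonal
  -- d)` is diagonal with nonzero entries.
  let G : Matrix ι ι ℝ → Matrix ι ι ℝ := fun M => of fun k i => aeval M (sqCofactor d (d i)) k i
  have hc : Continuous fun M => (G M).det := by
    refine Continuous.matrix_det (continuous_matrix fun k i => ?_)
    exact (Polynomial.continuous_aeval (sqCofactor d (d i))).matrix_elem k i
  have h0 : (G (diagonal d)).det ≠ 0 := by
    have : G (diagonal d) = diagonal fun i => (sqCofactor d (d i)).eval (d i) := by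
      ext k i
      simp only [G, of_apply, aeval_diagonal, diagonal_apply]
      split_ifs with h
      · rw [h]
      · rfl
    rw [this, det_diagonal]
    exact Finset.prod_ne_zero_iff.2 fun i _ => eval_sqCofactor_ne_zero hd i
  filter_upwards [hc.continuousAt.eventually_ne h0] with M hM hblock hMw
  have hu : IsUnit (G M).det := isUnit_iff_ne_zero.2 hM
  -- In entry `(k, j)` only the indices `i` with `d i = d j` contribute, so every cofactor in the
  -- sum may be replaced by that of `d j`, and `diagonal d` by the scalar `d j`.
  have hG : G M * (M - diagonal d) = 0 := by
    ext k j
    have h1 : aeval M (sqCofactor d (d j)) * (M - diagonal fun _ => d j) = 0 := by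
      have e := congrArg (aeval M) (sqCofactor_mul d j)
      rw [map_mul, map_mul, aeval_comp] at e
      simp only [map_sub, aeval_X, aeval_C, map_pow] at e
      rw [pow_two, hMw] at e
      simpa [Algebra.algebraMap_eq_smul_one, smul_one_eq_diagonal] using e
    have h2 := congrFun (congrFun h1 k) j
    rw [← h2, mul_apply, mul_apply]
    refine Finset.sum_congr rfl fun i _ => ?_
    by_cases hij : d i = d j
    · simp only [G, of_apply, sub_apply, hij, diagonal_apply]
    · have hne : i ≠ j := fun h => hij (by rw [h])
      simp [hblock i j hij, hne]
  have : M - diagonal d = 0 := by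
    rw [← Matrix.one_mul (M - diagonal d), ← Matrix.nonsing_inv_mul _ hu, Matrix.mul_assoc, hG,
      Matrix.mul_zero]
  exact sub_eq_zero.1 this

/-- The matrix with upper left block `diagonal d` and all other entries zero. -/
def singularBlock (α β : Type*) (d : ι → ℝ) : Matrix (ι ⊕ α) (ι ⊕ β) ℝ :=
  fromBlocks (diagonal d) 0 0 0

theorem eventually_slice {d : ι → ℝ} (hd : ∀ i, 0 < d i) :
    ∀ᶠ B in 𝓝 (0 : Matrix (ι ⊕ α) (ι ⊕ β) ℝ),
      (∀ i j, d i ≠ d j → B (.inl i) (.inl j) = 0) → B.toBlocks₁₁ᵀ = B.toBlocks₁₁ →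
      B.toBlocks₁₂ = 0 → B.toBlocks₂₁ = 0 →
      singularBlock α β d + B ∈ orthogonalOrbit (singularBlock α β d) → B = 0 := by
  have c1 : Filter.Tendsto (fun B : Matrix (ι ⊕ α) (ι ⊕ β) ℝ => diagonal d + B.toBlocks₁₁) (𝓝 0)
      (𝓝 (diagonal d)) := by
    have : Continuous (fun B : Matrix (ι ⊕ α) (ι ⊕ β) ℝ => diagonal d + B.toBlocks₁₁) :=
      continuous_const.add (continuous_matrix fun i j => continuous_id.matrix_elem _ _)
    have h := this.tendsto 0
    have e : diagonal d + (0 : Matrix (ι ⊕ α) (ι ⊕ β) ℝ).toBlocks₁₁ = diagonal d := by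
      ext i j; simp [toBlocks₁₁]
    rwa [e] at h
  have c2 : Filter.Tendsto (fun B : Matrix (ι ⊕ α) (ι ⊕ β) ℝ => B.toBlocks₂₂) (𝓝 0) (𝓝 0) := by
    have : Continuous (fun B : Matrix (ι ⊕ α) (ι ⊕ β) ℝ => B.toBlocks₂₂) :=
      continuous_matrix fun i j => continuous_id.matrix_elem _ _
    exact this.tendsto 0
  filter_upwards [c1.eventually (eventually_eq_diagonal_of_mul_aeval_eq_zero hd),
    c2.eventually (eventually_eq_zero_of_mul_aeval_eq_zero (eval_zero_sqRootsPoly hd))]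
    with B hB1 hB2 hblock hsymm h12 h21 hB
  -- The polynomial kills the upper left block; the nonzero `w(0)` in the lower right is killed by
  -- the zero block of `singularBlock`.
  have hS : singularBlock α β d * aeval ((singularBlock α β d)ᵀ * singularBlock α β d)
      (sqRootsPoly d) = 0 := by
    have : (singularBlock α β d)ᵀ * singularBlock α β d =
        fromBlocks (diagonal fun i => d i ^ 2) 0 0 0 := by
      simp [singularBlock, fromBlocks_transpose, fromBlocks_multiply, pow_two]
    rw [this, aeval_fromBlocks_diagonal, aeval_diagonal, singularBlock, fromBlocks_multiply]
    simp [eval_sq_sqRootsPoly]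
  have key := mul_aeval_eq_zero_of_mem_orthogonalOrbit hB hS
  have e : singularBlock α β d + B = fromBlocks (diagonal d + B.toBlocks₁₁) 0 0 B.toBlocks₂₂ := by
    conv_lhs => rw [← fromBlocks_toBlocks B]
    rw [singularBlock, fromBlocks_add, h12, h21]
    simp
  have hsymm' : (diagonal d + B.toBlocks₁₁)ᵀ = diagonal d + B.toBlocks₁₁ := by
    rw [transpose_add, hsymm, diagonal_transpose]
  -- Symmetry of the upper left block `M` turns `Mᵀ * M` into `M * M`, the form that the cofactors
  -- factor.
  have e2 : (singularBlock α β d + B)ᵀ * (singularBlock α β d + B) =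
      fromBlocks ((diagonal d + B.toBlocks₁₁) * (diagonal d + B.toBlocks₁₁)) 0 0
        (B.toBlocks₂₂ᵀ * B.toBlocks₂₂) := by
    rw [e, fromBlocks_transpose, fromBlocks_multiply, hsymm']
    simp
  rw [e2, aeval_fromBlocks_diagonal, e, fromBlocks_multiply, ← fromBlocks_zero, fromBlocks_inj] at key
  simp only [Matrix.mul_zero, Matrix.zero_mul, add_zero, zero_add] at key
  have r1 := hB1 (fun i j hij => by
    have hne : i ≠ j := fun h => hij (by rw [h])
    simp [hne, toBlocks₁₁, hblock i j hij]) key.1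
  have r2 := hB2 key.2.2.2
  rw [← fromBlocks_toBlocks B, h12, h21, r2, add_eq_left.1 r1, fromBlocks_zero]

end Rigidity

/-! ### Explicit tangent and normal components at the block matrix -/

section Slice

variable {ι α β : Type*}

/-- The projection onto the normal space, along the tangent space, of the orbit of
`singularBlock α β d`. -/
noncomputable def normalProjection (α β : Type*) (d : ι → ℝ) :
    Matrix (ι ⊕ α) (ι ⊕ β) ℝ →ₗ[ℝ] Matrix (ι ⊕ α) (ι ⊕ β) ℝ where
  toFun B := fromBlocks
    (of fun i j => if d i = d j then (B (.inl i) (.inl j) + B (.inl j) (.inl i)) / 2 else 0)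
    0 0 B.toBlocks₂₂
  map_add' A B := by
    ext (i | a) (j | b) <;> simp [toBlocks₂₂]
    split_ifs <;> ring
  map_smul' t B := by
    ext (i | a) (j | b) <;> simp [toBlocks₂₂]
    split_ifs <;> ring

/-- The row part of a skew-symmetric pair that realizes a given tangent vector of the orbit of
`singularBlock α β d`. -/
noncomputable def rowGenerator (α β : Type*) (d : ι → ℝ) :
    Matrix (ι ⊕ α) (ι ⊕ β) ℝ →ₗ[ℝ] Matrix (ι ⊕ α) (ι ⊕ α) ℝ where
  toFun B := fromBlocks
    -- For skew `X` and `Z`, entries `(i, j)` and `(j, i)` give `d j * X i j + d i * Z i j = B i j`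
    -- and `d i * X i j + d j * Z i j = -B j i`, with determinant `d j ^ 2 - d i ^ 2`. If `d i = d
    -- j`, only the skew part of `B` can be reached, and `Z i j = 0` is chosen.
    (of fun i j => if d i = d j then (B (.inl i) (.inl j) - B (.inl j) (.inl i)) / (2 * d i)
      else (d j * B (.inl i) (.inl j) + d i * B (.inl j) (.inl i)) / (d j ^ 2 - d i ^ 2))
    (of fun i a => -(B (.inr a) (.inl i) / d i)) (of fun a i => B (.inr a) (.inl i) / d i) 0
  map_add' A B := by
    ext (i | a) (j | b) <;> simp
    · split_ifs <;> ring
    · ring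
    · ring
  map_smul' t B := by
    ext (i | a) (j | b) <;> simp
    · split_ifs <;> ring
    · ring
    · ring

/-- The column part of a skew-symmetric pair that realizes a given tangent vector of the orbit of
`singularBlock α β d`. -/
noncomputable def colGenerator (α β : Type*) (d : ι → ℝ) :
    Matrix (ι ⊕ α) (ι ⊕ β) ℝ →ₗ[ℝ] Matrix (ι ⊕ β) (ι ⊕ β) ℝ where
  toFun B := fromBlocks
    -- The other unknown of the same two-by-two system, with the matching choice 0 in the degenerate
    -- case.
    (of fun i j => if d i = d j then 0
      else (d i * B (.inl i) (.inl j) + d j * B (.inl j) (.inl i)) / (d i ^ 2 - d j ^ 2))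
    (of fun i b => B (.inl i) (.inr b) / d i) (of fun b i => -(B (.inl i) (.inr b) / d i)) 0
  map_add' A B := by
    ext (i | a) (j | b) <;> simp
    · split_ifs <;> ring
    · ring
    · ring
  map_smul' t B := by
    ext (i | a) (j | b) <;> simp
    · split_ifs <;> ring
    · ring
    · ring

theorem rowGenerator_transpose (d : ι → ℝ) (B : Matrix (ι ⊕ α) (ι ⊕ β) ℝ) :
    (rowGenerator α β d B)ᵀ = -rowGenerator α β d B := by
  ext (i | a) (j | b) <;> simp [rowGenerator]
  by_cases h : d i = d j
  · simp only [h, if_true]; ring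
  · rw [if_neg h, if_neg (Ne.symm h), ← neg_sub (d j ^ 2), div_neg]; ring

theorem colGenerator_transpose (d : ι → ℝ) (B : Matrix (ι ⊕ α) (ι ⊕ β) ℝ) :
    (colGenerator α β d B)ᵀ = -colGenerator α β d B := by
  ext (i | a) (j | b) <;> simp [colGenerator]
  by_cases h : d i = d j
  · simp only [h, if_true]; ring
  · rw [if_neg h, if_neg (Ne.symm h), ← neg_sub (d i ^ 2), div_neg]; ring

theorem generators_add_normalProjection [Fintype ι] [Fintype α] [Fintype β] [DecidableEq ι] {d : ι → ℝ} (hd : ∀ i, 0 < d i)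
    (B : Matrix (ι ⊕ α) (ι ⊕ β) ℝ) :
    rowGenerator α β d B * singularBlock α β d + singularBlock α β d * colGenerator α β d B +
      normalProjection α β d B = B := by
  have hd' := fun i => (hd i).ne'
  simp only [rowGenerator, colGenerator, normalProjection, singularBlock, LinearMap.coe_mk,
    AddHom.coe_mk, fromBlocks_multiply, fromBlocks_add]
  ext (i | a) (j | b)
  · simp only [fromBlocks_apply₁₁, add_apply, mul_diagonal, diagonal_mul, of_apply,
      Matrix.mul_zero, Matrix.zero_mul, add_zero]
    split_ifs with h
    · have := hd' j
      rw [h]; field_simp; ring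
    · have h1 : d j ^ 2 - d i ^ 2 ≠ 0 := by
        rw [sub_ne_zero]
        intro h2
        exact h ((sq_eq_sq₀ (hd j).le (hd i).le).1 h2).symm
      rw [← neg_sub (d j ^ 2) (d i ^ 2), div_neg]
      field_simp; ring
  · have := hd' i
    simp [diagonal_mul]; field_simp
  · have := hd' j
    simp [mul_diagonal]; field_simp
  · simp [toBlocks₂₂]

theorem isSmoothSubmanifold_orthogonalOrbit_singularBlock [Fintype ι] [Fintype α] [Fintype β]
    [DecidableEq ι] [DecidableEq α] [DecidableEq β] {d : ι → ℝ} (hd : ∀ i, 0 < d i) :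
    IsSmoothSubmanifold (orthogonalOrbit (singularBlock α β d))
      (Module.finrank ℝ (LinearMap.ker (normalProjection α β d))) := by
  refine isSmoothSubmanifold_orthogonalOrbit_of_slice _ (rowGenerator α β d)
    (normalProjection α β d) (colGenerator α β d) (generators_add_normalProjection hd)
    (rowGenerator_transpose d) (colGenerator_transpose d) ?_
  have hc : Filter.Tendsto (normalProjection α β d) (𝓝 0) (𝓝 0) := by
    have := (LinearMap.continuous_of_finiteDimensional (normalProjection α β d)).tendsto 0
    rwa [map_zero] at this
  filter_upwards [hc.eventually (eventually_slice hd)] with B hB hmem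
  refine hB (fun i j hij => ?_) ?_ ?_ ?_ hmem
  · simp [normalProjection, hij]
  · ext i j
    by_cases h : d i = d j
    · simp [normalProjection, h, add_comm]
    · simp [normalProjection, h, Ne.symm h]
  · simp [normalProjection]
  · simp [normalProjection]

end Slice

end Matrix

/-! ### Dimension of the tangent space -/

namespace Matrix

section Dimension

variable {ι α β : Type*}

/-- A tangent vector of the orbit of `singularBlock α β d` is determined by its entries outside the
lower right block, where of two entries that are negatives of each other only one is kept. -/
noncomputable def kerNormalProjectionEquiv [LinearOrder ι] (α β : Type*) (d : ι → ℝ) :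
    LinearMap.ker (normalProjection α β d) ≃ₗ[ℝ]
      ({x : ι × ι // d x.1 ≠ d x.2 ∨ x.1 < x.2} ⊕ (ι × β ⊕ α × ι) → ℝ) where
  toFun B := Sum.elim (fun x => B.1 (.inl x.1.1) (.inl x.1.2))
    (Sum.elim (fun x => B.1 (.inl x.1) (.inr x.2)) (fun x => B.1 (.inr x.1) (.inl x.2)))
  map_add' A B := by ext (x | x | x) <;> simp
  map_smul' t B := by ext (x | x | x) <;> simp
  invFun f := ⟨fromBlocks
    (of fun i j => if h : d i ≠ d j ∨ i < j then f (.inl ⟨(i, j), h⟩)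
      else if h : j < i then -f (.inl ⟨(j, i), .inr h⟩) else 0)
    (of fun i b => f (.inr (.inl (i, b)))) (of fun a i => f (.inr (.inr (a, i)))) 0, by
      rw [LinearMap.mem_ker]
      ext (i | a) (j | b)
      · simp only [normalProjection, LinearMap.coe_mk, AddHom.coe_mk, fromBlocks_apply₁₁, of_apply,
          zero_apply]
        by_cases h : d i = d j
        · rcases lt_trichotomy i j with hij | rfl | hij
          · simp [h, hij, hij.not_gt]
          · simp
          · simp [h, hij, hij.not_gt]
        · simp [h]
      · simp [normalProjection]
      · simp [normalProjection]
      · simp [normalProjection, toBlocks₂₂]⟩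
  left_inv := by
    rintro ⟨B, hB⟩
    rw [LinearMap.mem_ker] at hB
    ext (i | a) (j | b)
    · have h1 := congrFun (congrFun hB (.inl i)) (.inl j)
      simp only [normalProjection, LinearMap.coe_mk, AddHom.coe_mk, fromBlocks_apply₁₁, of_apply,
          zero_apply] at h1
      simp only [fromBlocks_apply₁₁, of_apply, Sum.elim_inl]
      split_ifs with h2 h3
      · rfl
      · push Not at h2
        rw [if_pos h2.1] at h1
        linarith
      · push Not at h2 h3
        obtain rfl := le_antisymm h3 h2.2
        rw [if_pos rfl] at h1
        linarith
    · simp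
    · simp
    · have h1 := congrFun (congrFun hB (.inr a)) (.inr b)
      simpa [normalProjection, toBlocks₂₂] using h1.symm
  right_inv f := by
    ext (x | x | x)
    · simp [x.2]
    · simp
    · simp

/-- Pairs split into those with `d` different, the diagonal, and the strictly ordered pairs with `d`
equal, whose two halves are exchanged by the swap. Doubling and adding avoids division and
subtraction in `ℕ`. -/
theorem two_mul_card_ne_or_lt [Fintype ι] [LinearOrder ι] {γ : Type*} [DecidableEq γ] (d : ι → γ) :
    2 * (Finset.univ.filter fun x : ι × ι => d x.1 ≠ d x.2 ∨ x.1 < x.2).card +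
      (Finset.univ.filter fun x : ι × ι => d x.1 = d x.2).card + Fintype.card ι =
      2 * (Fintype.card ι * Fintype.card ι) := by
  have hdiag : (Finset.univ.filter fun x : ι × ι => x.1 = x.2).card = Fintype.card ι := by
    rw [Finset.card_filter, Fintype.sum_prod_type]
    simp only [Finset.sum_ite_eq, Finset.mem_univ, if_true, Finset.sum_const, Finset.card_univ,
      smul_eq_mul, mul_one]
  have hswap : (Finset.univ.filter fun x : ι × ι => d x.1 = d x.2 ∧ x.2 < x.1).card =
      (Finset.univ.filter fun x : ι × ι => d x.1 = d x.2 ∧ x.1 < x.2).card := by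
    refine Finset.card_equiv (Equiv.prodComm ι ι) fun x => ?_
    simp [eq_comm]
  have hsplit : ∀ (p q : ι × ι → Prop) [DecidablePred p] [DecidablePred q], (∀ x, p x → ¬ q x) →
      (Finset.univ.filter fun x => p x ∨ q x).card =
        (Finset.univ.filter p).card + (Finset.univ.filter q).card := by
    intro p q _ _ hpq
    rw [Finset.filter_or, Finset.card_union_of_disjoint]
    exact Finset.disjoint_filter.2 fun x _ => hpq x
  have h1 := hsplit (fun x => d x.1 ≠ d x.2) (fun x => d x.1 = d x.2 ∧ x.1 < x.2)
    (fun x h h' => h h'.1)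
  have h2 := hsplit (fun x => d x.1 = d x.2 ∧ x.2 < x.1) (fun x => d x.1 = d x.2 ∧ x.1 < x.2)
    (fun x h h' => h.2.not_gt h'.2)
  have h3 := hsplit (fun x => d x.1 = d x.2 ∧ x.2 < x.1 ∨ d x.1 = d x.2 ∧ x.1 < x.2)
    (fun x => x.1 = x.2) (by
      rintro x (h | h) h'
      · exact h.2.ne h'.symm
      · exact h.2.ne h')
  have h4 := hsplit (fun x => d x.1 ≠ d x.2) (fun x => d x.1 = d x.2) (fun x h h' => h h')
  have e1 : (Finset.univ.filter fun x : ι × ι => d x.1 ≠ d x.2 ∨ x.1 < x.2) =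
      Finset.univ.filter fun x : ι × ι => d x.1 ≠ d x.2 ∨ (d x.1 = d x.2 ∧ x.1 < x.2) := by
    ext x; simp; tauto
  have e3 : (Finset.univ.filter fun x : ι × ι => d x.1 = d x.2) =
      Finset.univ.filter fun x : ι × ι =>
        (d x.1 = d x.2 ∧ x.2 < x.1 ∨ d x.1 = d x.2 ∧ x.1 < x.2) ∨ x.1 = x.2 := by
    ext x
    simp only [Finset.mem_filter, Finset.mem_univ, true_and]
    constructor
    · intro h
      rcases lt_trichotomy x.1 x.2 with hx | hx | hx
      · exact .inl (.inr ⟨h, hx⟩)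
      · exact .inr hx
      · exact .inl (.inl ⟨h, hx⟩)
    · rintro ((h | h) | h)
      · exact h.1
      · exact h.1
      · rw [h]
  have e4 : (Finset.univ.filter fun x : ι × ι => d x.1 ≠ d x.2 ∨ d x.1 = d x.2).card =
      Fintype.card ι * Fintype.card ι := by
    rw [Finset.filter_true_of_mem (fun x _ => (em (d x.1 = d x.2)).symm), Finset.card_univ,
      Fintype.card_prod]
  rw [← e1] at h1
  rw [← e3] at h3
  omega

theorem two_mul_finrank_ker_normalProjection [Fintype ι] [LinearOrder ι] [Fintype α] [Fintype β]
    (d : ι → ℝ) :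
    2 * Module.finrank ℝ (LinearMap.ker (normalProjection α β d)) +
      (Finset.univ.filter fun x : ι × ι => d x.1 = d x.2).card + Fintype.card ι =
      2 * (Fintype.card ι * Fintype.card ι + Fintype.card ι * Fintype.card β +
        Fintype.card α * Fintype.card ι) := by
  classical
  rw [(kerNormalProjectionEquiv α β d).finrank_eq, Module.finrank_fintype_fun_eq_card,
    Fintype.card_sum, Fintype.card_sum, Fintype.card_prod, Fintype.card_prod,
    Fintype.card_subtype]
  have := two_mul_card_ne_or_lt d
  omega

end Dimension

/-! ### Reindexing orbits from sum types to `Fin` -/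

section Reindex

variable {m n m' n' : Type*} [Fintype m] [Fintype n] [Fintype m'] [Fintype n']
  [DecidableEq m] [DecidableEq n] [DecidableEq m'] [DecidableEq n']

theorem reindex_mem_orthogonalGroup (e : n ≃ n') {U : Matrix n n ℝ}
    (hU : U ∈ Matrix.orthogonalGroup n ℝ) : reindex e e U ∈ Matrix.orthogonalGroup n' ℝ := by
  rw [mem_orthogonalGroup_iff] at hU ⊢
  rw [transpose_reindex, reindex_apply, reindex_apply, submatrix_mul_equiv, hU,
    submatrix_one_equiv]

theorem reindex_mem_orthogonalOrbit (e : n ≃ n') (f : m ≃ m') {S A : Matrix n m ℝ}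
    (hA : A ∈ orthogonalOrbit S) : reindex e f A ∈ orthogonalOrbit (reindex e f S) := by
  obtain ⟨U, hU, V, hV, rfl⟩ := hA
  refine ⟨_, reindex_mem_orthogonalGroup e hU, _, reindex_mem_orthogonalGroup f hV, ?_⟩
  simp only [reindex_apply, transpose_submatrix, submatrix_mul_equiv]

theorem image_reindex_orthogonalOrbit (e : n ≃ n') (f : m ≃ m') (S : Matrix n m ℝ) :
    reindex e f '' orthogonalOrbit S = orthogonalOrbit (reindex e f S) := by
  ext A
  constructor
  · rintro ⟨B, hB, rfl⟩
    exact reindex_mem_orthogonalOrbit e f hB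
  · intro hA
    refine ⟨reindex e.symm f.symm A, ?_, by simp⟩
    simpa using reindex_mem_orthogonalOrbit e.symm f.symm hA

end Reindex

end Matrix

theorem IsSmoothSubmanifold.reindex {m n m' n' : Type*} [Fintype m] [Fintype n] [Fintype m']
    [Fintype n'] {s : Set (Matrix n m ℝ)} {k : ℕ} (h : IsSmoothSubmanifold s k)
    (e : n ≃ n') (f : m ≃ m') : IsSmoothSubmanifold (Matrix.reindex e f '' s) k :=
  IsSmoothSubmanifold.image h (Matrix.reindexLinearEquiv ℝ ℝ e f).toContinuousLinearEquiv

/-! ### The concrete singular value matrix and its multiplicities -/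

theorem singularValueMatrix_eq_reindex (p q : ℕ) {J : ℕ} (σ : Fin J → ℝ) (k : Fin J → ℕ) :
    singularValueMatrix ((∑ j, k j) + p) ((∑ j, k j) + q) σ k =
      Matrix.reindex finSumFinEquiv finSumFinEquiv
        (Matrix.singularBlock (Fin p) (Fin q) (repeatedValues σ k)) := by
  rw [← Equiv.symm_apply_eq, Matrix.reindex_symm]
  ext (i | a) (j | b)
  · simp only [Matrix.singularBlock, singularValueMatrix, Matrix.reindex_apply, Equiv.symm_symm,
      Matrix.submatrix_apply, finSumFinEquiv_apply_left, Matrix.of_apply, Fin.val_castAdd,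
      Matrix.fromBlocks_apply₁₁, Matrix.diagonal_apply, Fin.ext_iff, i.2, and_true]
    split_ifs <;> rfl
  · have : (i : ℕ) ≠ (∑ j, k j) + b := by omega
    simp [Matrix.singularBlock, singularValueMatrix, this]
  · simp [Matrix.singularBlock, singularValueMatrix]
  · simp [Matrix.singularBlock, singularValueMatrix]

/-- Since `σ` is injective, two positions carry the same value iff they lie in the same block, and
block `j` contributes `k j * k j` pairs. -/
theorem card_repeatedValues_eq {J : ℕ} {σ : Fin J → ℝ} (hσ : Function.Injective σ)
    (k : Fin J → ℕ) :
    (Finset.univ.filter fun x : Fin (∑ j, k j) × Fin (∑ j, k j) =>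
      repeatedValues σ k x.1 = repeatedValues σ k x.2).card = ∑ j, k j * k j := by
  have hinner : ∀ j : Fin J, ∑ y : Σ j, Fin (k j), (if j = y.1 then 1 else 0) = k j := by
    intro j
    refine (Fintype.sum_sigma _).trans ?_
    change ∑ i, ∑ _ : Fin (k i), (if j = i then 1 else 0) = k j
    simp
  have key : ∑ x : Σ j, Fin (k j), ∑ y : Σ j, Fin (k j), (if x.1 = y.1 then 1 else 0) =
      ∑ j, k j * k j := by
    simp only [hinner, Fintype.sum_sigma, Finset.sum_const, Finset.card_univ, Fintype.card_fin,
      smul_eq_mul]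
  rw [Finset.card_filter, Fintype.sum_prod_type, ← key, ← finSigmaFinEquiv.sum_comp]
  refine Finset.sum_congr rfl fun x _ => ?_
  rw [← finSigmaFinEquiv.sum_comp]
  refine Finset.sum_congr rfl fun y _ => ?_
  simp only [repeatedValues, hσ.eq_iff, Equiv.symm_apply_apply]

theorem theorem9 (n m r J : ℕ) (σ : Fin J → ℝ) (k : Fin J → ℕ)
    (hσ : StrictAnti σ) (hσpos : ∀ j, 0 < σ j) (hk : ∀ j, 1 ≤ k j)
    (hr : r = ∑ j, k j) (hrn : r ≤ n) (hrm : r ≤ m) :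
    ∃ d : ℕ,
      HasRealDimension (matricesWithSingularValueMatrix (singularValueMatrix n m σ k)) d ∧
      (d : ℝ) = (n : ℝ) * (n - 1) / 2 + (m : ℝ) * (m - 1) / 2
        - ((n : ℝ) - r) * ((n : ℝ) - r - 1) / 2 - ((m : ℝ) - r) * ((m : ℝ) - r - 1) / 2
        - (1 / 2) * ∑ j, (k j : ℝ) * ((k j : ℝ) - 1) ∧
      (d : ℝ) = ((n : ℝ) + m - r) * r - r - (1 / 2) * ∑ j, (k j : ℝ) * ((k j : ℝ) - 1) := by
  -- Writing `n = r + p` and `m = r + q` exposes the block shape and removes the truncated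
  -- subtractions.
  obtain ⟨p, rfl⟩ := Nat.exists_eq_add_of_le hrn
  obtain ⟨q, rfl⟩ := Nat.exists_eq_add_of_le hrm
  subst hr
  have hpos : ∀ i, 0 < repeatedValues σ k i := fun i => hσpos _
  have hdim := Matrix.two_mul_finrank_ker_normalProjection (α := Fin p) (β := Fin q)
    (repeatedValues σ k)
  rw [card_repeatedValues_eq hσ.injective] at hdim
  simp only [Fintype.card_fin] at hdim
  have hsub := (Matrix.isSmoothSubmanifold_orthogonalOrbit_singularBlock (α := Fin p)
    (β := Fin q) hpos).reindex finSumFinEquiv finSumFinEquiv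
  rw [Matrix.image_reindex_orthogonalOrbit, ← singularValueMatrix_eq_reindex] at hsub
  generalize Module.finrank ℝ (LinearMap.ker (Matrix.normalProjection (Fin p) (Fin q)
    (repeatedValues σ k))) = N at hdim hsub
  have hsum : ∑ j, (k j : ℝ) * ((k j : ℝ) - 1) =
      ((∑ j, k j * k j : ℕ) : ℝ) - ((∑ j, k j : ℕ) : ℝ) := by
    push_cast
    rw [← Finset.sum_sub_distrib]
    exact Finset.sum_congr rfl fun j _ => by ring
  have hdim' := congrArg (Nat.cast : ℕ → ℝ) hdim
  rw [hsum]
  push_cast at hdim' ⊢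
  -- `matricesWithSingularValueMatrix` unfolds to `orthogonalOrbit`. Both formulas are half of the
  -- identity `2 * N + ∑ k j ^ 2 + r = 2 * (r ^ 2 + r * q + p * r)`.
  refine ⟨N, ⟨⟨_, Matrix.self_mem_orthogonalOrbit _⟩, hsub⟩, ?_, ?_⟩ <;>
    linear_combination hdim' / 2
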